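/- Let $d\in\{1,2\}$, let $\Omega\subset\mathbb{R}^d$ be a bounded open set, let $\varepsilon>0$, and let $\varphi:\Omega\to\mathbb{R}$ be measurable with $\varphi\ge\nu>0$ almost everywhere in $\Omega$ for some constant $\nu$. Let $X=H_0^1(\Omega)$ be the closure of $C_c^\infty(\Omega)$ in $H^1(\Omega)$, $X'=H^{-1}(\Omega)$ its topological dual, and $\langle -\Delta w,z\rangle=\int_\Omega\nabla w\cdot\nabla z\,\mathrm{d}x$ for $w,z\in X$. Let $D$ be either the weak gradient $\nabla:X\to L^2(\Omega)^d$ or the restriction to $X$ of a bounded linear operator $D_\mu:L^2(\Omega)\to L^2(\Omega)^d$ (for instance of an operator that is bounded from $L^p(\Omega)$ to $L^p(\Omega)^d$ for all $1\le p\le\infty$). For vectors $\xi,\eta\in\mathbb{R}^d$ with $\xi\neq0$ and a number $c$ put $$G_P(c,\xi)\eta=\chi_{(0,1)}(|\xi|-c)\,\frac{\xi\cdot\eta}{|\xi|}\,\frac{\xi}{|\xi|}+\min\bigl(1,\max(0,|\xi|-c)\bigr)\,\frac1{|\xi|}\Bigl(\eta-\frac{\xi\cdot\eta}{|\xi|^2}\,\xi\Bigr),$$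 and for $u\in X$ put $\Omega^+(u)=\{x\in\Omega: |Du(x)|>0\}$. Then for every $u\in X$ the Newton derivative $G_{\mathcal{P}}(u)$, for $\mathcal{P}=\mathcal{P}^{\nabla}$ (case $D=\nabla$) and for $\mathcal{P}=\mathcal{P}^{D_\mu}$ (case $D=D_\mu$), given by $$\langle G_{\mathcal{P}}(u)v,w\rangle=\int_{\Omega^+(u)}\bigl(G_P(\varphi(x),Du(x))\,Dv(x)\bigr)\cdot Dw(x)\,\mathrm{d}x\qquad(v,w\in X),$$ is well defined (the integrals converge) as a bounded linear operator $X\to X'$; it is monotone, that is, $\langle G_{\mathcal{P}}(u)z,z\rangle\ge0$ for all $z\in X$; and for every $h\in X'$ there exists a unique $w\in X$ such that $$\langle-\varepsilon\Delta w,z\rangle+\langle G_{\mathcal{P}}(u)w,z\rangle=\langle h,z\rangle\qquad\text{for all }z\in X.$$ -/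

import Mathlib

set_option maxSynthPendingDepth 3

open MeasureTheory Set Filter Topology
open scoped ContDiff

noncomputable section

/-- Euclidean space `ℝ^d`. -/
abbrev Eucl (d : ℕ) : Type := EuclideanSpace ℝ (Fin d)

/-- The scalar space `L²(Ω)`. -/
abbrev L2 {d : ℕ} (Ω : Set (Eucl d)) : Type := Lp ℝ 2 (volume.restrict Ω)

/-- The space `L²(Ω)^d` of square integrable vector fields. -/
abbrev L2Vec {d : ℕ} (Ω : Set (Eucl d)) : Type := Lp (Eucl d) 2 (volume.restrict Ω)

/-- Test functions: elements of `C_c^∞(Ω)`. -/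
def IsTestFunction {d : ℕ} (Ω : Set (Eucl d)) (ψ : Eucl d → ℝ) : Prop :=
  ContDiff ℝ ∞ ψ ∧ HasCompactSupport ψ ∧ tsupport ψ ⊆ Ω

/-- The partial derivative `∂_i ψ`. -/
def partialD {d : ℕ} (i : Fin d) (ψ : Eucl d → ℝ) (x : Eucl d) : ℝ :=
  fderiv ℝ ψ x (EuclideanSpace.single i 1)

/-- `g` is the weak gradient of `v` on `Ω`. -/
def HasWeakGradient {d : ℕ} (Ω : Set (Eucl d)) (v : Eucl d → ℝ) (g : Eucl d → Eucl d) : Prop :=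
  ∀ ψ : Eucl d → ℝ, IsTestFunction Ω ψ → ∀ i : Fin d,
    ∫ x in Ω, v x * partialD i ψ x = -∫ x in Ω, g x i * ψ x

section helpers

variable {d : ℕ} {Ω : Set (Eucl d)} {ψ : Eucl d → ℝ}

theorem IsTestFunction.memLp (hψ : IsTestFunction Ω ψ) : MemLp ψ 2 (volume.restrict Ω) :=
  (hψ.1.continuous.memLp_of_hasCompactSupport hψ.2.1).restrict Ω

theorem IsTestFunction.memLp_partialD (hψ : IsTestFunction Ω ψ) (i : Fin d) :
    MemLp (partialD i ψ) 2 (volume.restrict Ω) := by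
  have hc : Continuous (partialD i ψ) :=
    (hψ.1.continuous_fderiv (by simp)).clm_apply continuous_const
  have hs : HasCompactSupport (partialD i ψ) := hψ.2.1.fderiv_apply (𝕜 := ℝ) _
  exact (hc.memLp_of_hasCompactSupport hs).restrict Ω

theorem L2Vec.memLp_coord (g : L2Vec Ω) (i : Fin d) :
    MemLp (fun x => g x i) 2 (volume.restrict Ω) :=
  (Lp.memLp g).continuousLinearMap_comp (EuclideanSpace.proj (𝕜 := ℝ) i)

theorem IsTestFunction.integrable_left (hψ : IsTestFunction Ω ψ) (v : L2 Ω) (i : Fin d) :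
    Integrable (fun x => v x * partialD i ψ x) (volume.restrict Ω) :=
  (Lp.memLp v).integrable_mul (hψ.memLp_partialD i)

theorem IsTestFunction.integrable_right (hψ : IsTestFunction Ω ψ) (g : L2Vec Ω) (i : Fin d) :
    Integrable (fun x => g x i * ψ x) (volume.restrict Ω) :=
  (L2Vec.memLp_coord g i).integrable_mul hψ.memLp

end helpers

/-- The Sobolev space `H¹(Ω)`: pairs `(v, ∇v)` of a function in `L²(Ω)` and its weak gradient in
`L²(Ω)^d`, with the norm `(‖v‖² + ‖∇v‖²)^{1/2}`. -/
def H1 {d : ℕ} (Ω : Set (Eucl d)) : Submodule ℝ (WithLp 2 (L2 Ω × L2Vec Ω)) where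
  carrier := {p | HasWeakGradient Ω p.fst p.snd}
  zero_mem' := by
    intro ψ hψ i
    have h1 : ∫ x in Ω, (0 : L2 Ω) x * partialD i ψ x = 0 := by
      rw [← integral_zero (Eucl d) ℝ]
      refine integral_congr_ae ?_
      filter_upwards [Lp.coeFn_zero ℝ 2 (volume.restrict Ω)] with x hx
      rw [hx]; simp
    have h2 : ∫ x in Ω, (0 : L2Vec Ω) x i * ψ x = 0 := by
      rw [← integral_zero (Eucl d) ℝ]
      refine integral_congr_ae ?_
      filter_upwards [Lp.coeFn_zero (Eucl d) 2 (volume.restrict Ω)] with x hx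
      rw [hx]; simp
    simp only [WithLp.zero_fst, WithLp.zero_snd]
    rw [h1, h2, neg_zero]
  add_mem' := by
    intro p q hp hq ψ hψ i
    have h1 : ∫ x in Ω, (p.fst + q.fst : L2 Ω) x * partialD i ψ x
        = (∫ x in Ω, p.fst x * partialD i ψ x) + ∫ x in Ω, q.fst x * partialD i ψ x := by
      rw [← integral_add (hψ.integrable_left p.fst i) (hψ.integrable_left q.fst i)]
      refine integral_congr_ae ?_
      filter_upwards [Lp.coeFn_add p.fst q.fst] with x hx
      rw [hx]; simp [add_mul]
    have h2 : ∫ x in Ω, (p.snd + q.snd : L2Vec Ω) x i * ψ x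
        = (∫ x in Ω, p.snd x i * ψ x) + ∫ x in Ω, q.snd x i * ψ x := by
      rw [← integral_add (hψ.integrable_right p.snd i) (hψ.integrable_right q.snd i)]
      refine integral_congr_ae ?_
      filter_upwards [Lp.coeFn_add p.snd q.snd] with x hx
      rw [hx]; simp [add_mul]
    simp only [WithLp.add_fst, WithLp.add_snd]
    rw [h1, h2, hp ψ hψ i, hq ψ hψ i]
    ring
  smul_mem' := by
    intro c p hp ψ hψ i
    have h1 : ∫ x in Ω, (c • p.fst : L2 Ω) x * partialD i ψ x
        = c * ∫ x in Ω, p.fst x * partialD i ψ x := by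
      rw [← integral_const_mul]
      refine integral_congr_ae ?_
      filter_upwards [Lp.coeFn_smul c p.fst] with x hx
      rw [hx]; simp [mul_assoc]
    have h2 : ∫ x in Ω, (c • p.snd : L2Vec Ω) x i * ψ x
        = c * ∫ x in Ω, p.snd x i * ψ x := by
      rw [← integral_const_mul]
      refine integral_congr_ae ?_
      filter_upwards [Lp.coeFn_smul c p.snd] with x hx
      rw [hx]; simp [mul_assoc]
    simp only [WithLp.smul_fst, WithLp.smul_snd]
    rw [h1, h2, hp ψ hψ i]
    ring

/-- `C_c^∞(Ω)` as a subspace of `H¹(Ω)`. -/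
def testFunctions {d : ℕ} (Ω : Set (Eucl d)) : Submodule ℝ (H1 Ω) where
  carrier := {v | ∃ ψ : Eucl d → ℝ, IsTestFunction Ω ψ ∧
    (v : WithLp 2 (L2 Ω × L2Vec Ω)).fst =ᵐ[volume.restrict Ω] ψ}
  zero_mem' := by
    refine ⟨0, ⟨contDiff_const, HasCompactSupport.zero, by simp [tsupport]⟩, ?_⟩
    simpa using Lp.coeFn_zero ℝ 2 (volume.restrict Ω)
  add_mem' := by
    rintro v w ⟨ψ, hψ, hv⟩ ⟨χ, hχ, hw⟩
    refine ⟨ψ + χ, ⟨hψ.1.add hχ.1, hψ.2.1.add hχ.2.1,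
      (tsupport_add ψ χ).trans (union_subset hψ.2.2 hχ.2.2)⟩, ?_⟩
    simp only [Submodule.coe_add, WithLp.add_fst]
    exact (Lp.coeFn_add _ _).trans (hv.add hw)
  smul_mem' := by
    rintro c v ⟨ψ, hψ, hv⟩
    refine ⟨c • ψ, ⟨contDiff_const.smul hψ.1, hψ.2.1.smul_left (f := fun _ => c),
      (tsupport_smul_subset_right (fun _ => c) ψ).trans hψ.2.2⟩, ?_⟩
    simp only [Submodule.coe_smul, WithLp.smul_fst]
    exact (Lp.coeFn_smul c _).trans (hv.const_smul c)

/-- `H₀¹(Ω)`: the closure of `C_c^∞(Ω)` in `H¹(Ω)`. -/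
def H01 {d : ℕ} (Ω : Set (Eucl d)) : Submodule ℝ (H1 Ω) :=
  (testFunctions Ω).topologicalClosure

/-- `H^{-1}(Ω)`, the topological dual of `H₀¹(Ω)`. -/
abbrev Hminus1 {d : ℕ} (Ω : Set (Eucl d)) : Type := H01 Ω →L[ℝ] ℝ

/-- The inclusion `H₀¹(Ω) → L²(Ω)`. -/
def toL2 {d : ℕ} (Ω : Set (Eucl d)) : H01 Ω →L[ℝ] L2 Ω :=
  (WithLp.fstL 2 ℝ (L2 Ω) (L2Vec Ω)).comp ((H1 Ω).subtypeL.comp (H01 Ω).subtypeL)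

/-- The weak gradient `∇ : H₀¹(Ω) → L²(Ω)^d`. -/
def weakGrad {d : ℕ} (Ω : Set (Eucl d)) : H01 Ω →L[ℝ] L2Vec Ω :=
  (WithLp.sndL 2 ℝ (L2 Ω) (L2Vec Ω)).comp ((H1 Ω).subtypeL.comp (H01 Ω).subtypeL)

/-- The operator `-Δ : H₀¹(Ω) → H^{-1}(Ω)`, `⟨-Δ w, z⟩ = ∫_Ω ∇w · ∇z`. -/
def negLaplacian {d : ℕ} (Ω : Set (Eucl d)) : H01 Ω →L[ℝ] Hminus1 Ω :=
  ((weakGrad Ω).precomp ℝ).comp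
    ((isBoundedBilinearMap_inner (𝕜 := ℝ) (E := L2Vec Ω)).toContinuousLinearMap.comp (weakGrad Ω))

theorem negLaplacian_apply {d : ℕ} (Ω : Set (Eucl d)) (w z : H01 Ω) :
    negLaplacian Ω w z = ∫ x in Ω, inner ℝ (weakGrad Ω w x) (weakGrad Ω z x) :=
  L2.inner_def (𝕜 := ℝ) (weakGrad Ω w) (weakGrad Ω z)

/-! The pointwise ingredients of `G_P`. Here `c` stands for the value `φ(x)`, `ξ` for the value of
the base field at `x`, and `η` for the vector to which the linear map is applied. -/

/-- `(t)^± = min(1, max(0, t))`. -/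
def clip (t : ℝ) : ℝ := min 1 (max 0 t)

/-- The Newton derivative `χ_{(0,1)}` of `(·)^±`. -/
def clipDeriv (t : ℝ) : ℝ := (Ioo (0 : ℝ) 1).indicator (fun _ => 1) t

/-- `q(ξ) = ξ / |ξ|`. -/
def qDir {d : ℕ} (ξ : Eucl d) : Eucl d := ‖ξ‖⁻¹ • ξ

/-- `b(ξ) = (|ξ| - c)^±`. -/
def bClip {d : ℕ} (c : ℝ) (ξ : Eucl d) : ℝ := clip (‖ξ‖ - c)

/-- `G_b(ξ) η = χ_{(0,1)}(|ξ| - c) (ξᵀ η) / |ξ|`. -/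
def Gb {d : ℕ} (c : ℝ) (ξ η : Eucl d) : ℝ := clipDeriv (‖ξ‖ - c) * (inner ℝ ξ η / ‖ξ‖)

/-- `Q(ξ) η = |ξ|⁻¹ (η - ξ (ξᵀ η) / |ξ|²)`. -/
def Qproj {d : ℕ} (ξ η : Eucl d) : Eucl d := ‖ξ‖⁻¹ • (η - (inner ℝ ξ η / ‖ξ‖ ^ 2) • ξ)

/-- `G_P(ξ) η = q(ξ) G_b(ξ) η + b(ξ) Q(ξ) η`. -/
def GP {d : ℕ} (c : ℝ) (ξ η : Eucl d) : Eucl d := Gb c ξ η • qDir ξ + bClip c ξ • Qproj ξ η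

/-- `Ω⁺(u) = {x ∈ Ω : |D u(x)| > 0}`. -/
def OmegaPlus {d : ℕ} {Ω : Set (Eucl d)} (D : H01 Ω →L[ℝ] L2Vec Ω) (u : H01 Ω) : Set (Eucl d) :=
  {x ∈ Ω | 0 < ‖D u x‖}

/-- The integrand `(G_P(Du) Dv) · Dw` of `⟨G_𝒫(u) v, w⟩`. -/
def GcalPIntegrand {d : ℕ} {Ω : Set (Eucl d)} (φ : Eucl d → ℝ) (D : H01 Ω →L[ℝ] L2Vec Ω)
    (u v w : H01 Ω) (x : Eucl d) : ℝ :=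
  inner ℝ (GP (φ x) (D u x) (D v x)) (D w x)

/-- `G : H₀¹(Ω) → H^{-1}(Ω)` is the operator `G_𝒫(u)`, that is
`⟨G v, w⟩ = ∫_{Ω⁺(u)} (G_P(Du) Dv) · Dw` for all `v, w ∈ H₀¹(Ω)`, the integrals being convergent.
There is at most one such `G`. -/
def IsGcalP {d : ℕ} {Ω : Set (Eucl d)} (φ : Eucl d → ℝ) (D : H01 Ω →L[ℝ] L2Vec Ω)
    (u : H01 Ω) (G : H01 Ω →L[ℝ] Hminus1 Ω) : Prop :=
  ∀ v w : H01 Ω, IntegrableOn (GcalPIntegrand φ D u v w) (OmegaPlus D u) ∧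
    G v w = ∫ x in OmegaPlus D u, GcalPIntegrand φ D u v w x

end

/-! ### Cauchy–Schwarz for norms of `L²` functions -/

section CauchySchwarz

variable {α E F : Type*} [MeasurableSpace α] {μ : Measure α}
  [NormedAddCommGroup E] [NormedAddCommGroup F]

/-! For `c ≥ 0` and `ξ ≠ 0`, `GP c ξ` is a symmetric matrix with eigenvalue 0 or 1 along `ξ` and
`clip (‖ξ‖ - c) / ‖ξ‖ ∈ [0, 1]` on its orthogonal complement; for `ξ = 0` division by zero makes it
0. So it is positive semidefinite (`inner_GP_self_nonneg`) and uniformly bounded (`norm_GP_le`), and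
defines a bounded monotone form on `L²` (`formGP`). Inserting the continuous operator `D` in both
arguments gives `G`. The Poincaré inequality makes `-Δ` coercive; adding a monotone form preserves
coercivity, and Lax–Milgram gives the unique solution. -/

theorem integrable_norm_mul_norm (f : Lp E 2 μ) (g : Lp F 2 μ) :
    Integrable (fun x => ‖f x‖ * ‖g x‖) μ :=
  (Lp.memLp f).norm.integrable_mul (Lp.memLp g).norm

theorem integral_norm_mul_norm_le (f : Lp E 2 μ) (g : Lp F 2 μ) :
    ∫ x, ‖f x‖ * ‖g x‖ ∂μ ≤ ‖f‖ * ‖g‖ := by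
  have hf := (Lp.memLp f).norm
  have hg := (Lp.memLp g).norm
  have h : ∫ x, ‖f x‖ * ‖g x‖ ∂μ = inner ℝ (hf.toLp _) (hg.toLp _) := by
    rw [L2.inner_def]
    refine integral_congr_ae ?_
    filter_upwards [hf.coeFn_toLp, hg.coeFn_toLp] with x hx hy
    rw [hx, hy]
    simp [mul_comm]
  rw [h]
  refine (real_inner_le_norm _ _).trans_eq ?_
  rw [Lp.norm_toLp, Lp.norm_toLp, eLpNorm_norm, eLpNorm_norm, Lp.norm_def, Lp.norm_def]

end CauchySchwarz

/-! ### Completeness of the Sobolev spaces and the Poincaré inequality -/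

section Sobolev

variable {d : ℕ} {Ω : Set (Eucl d)}

theorem continuous_integral_mul_partialD {ψ : Eucl d → ℝ} (hψ : IsTestFunction Ω ψ) (i : Fin d) :
    Continuous fun v : L2 Ω => ∫ x in Ω, v x * partialD i ψ x := by
  have h : (fun v : L2 Ω => ∫ x in Ω, v x * partialD i ψ x)
      = fun v => inner ℝ ((hψ.memLp_partialD i).toLp _) v := by
    funext v
    rw [L2.inner_def]
    refine integral_congr_ae ?_
    filter_upwards [(hψ.memLp_partialD i).coeFn_toLp] with x hx
    rw [hx]
    simp
  rw [h]
  fun_prop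

theorem continuous_integral_coord_mul {ψ : Eucl d → ℝ} (hψ : IsTestFunction Ω ψ) (i : Fin d) :
    Continuous fun g : L2Vec Ω => ∫ x in Ω, g x i * ψ x := by
  have hm : MemLp (fun x => ψ x • EuclideanSpace.single i (1 : ℝ)) 2 (volume.restrict Ω) :=
    hψ.memLp.continuousLinearMap_comp
      ((ContinuousLinearMap.id ℝ ℝ).smulRight (EuclideanSpace.single i (1 : ℝ)))
  have h : (fun g : L2Vec Ω => ∫ x in Ω, g x i * ψ x) = fun g => inner ℝ (hm.toLp _) g := by
    funext g
    rw [L2.inner_def]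
    refine integral_congr_ae ?_
    filter_upwards [hm.coeFn_toLp] with x hx
    rw [hx, real_inner_smul_left, EuclideanSpace.inner_single_left]
    simp [mul_comm]
  rw [h]
  fun_prop

/-- Each test function and coordinate imposes an equality of two functionals continuous in `L²`.
Closedness yields the completeness that Lax–Milgram needs. -/
theorem isClosed_H1 (Ω : Set (Eucl d)) : IsClosed (H1 Ω : Set (WithLp 2 (L2 Ω × L2Vec Ω))) := by
  have h : (H1 Ω : Set (WithLp 2 (L2 Ω × L2Vec Ω))) =
      ⋂ (ψ : Eucl d → ℝ) (_ : IsTestFunction Ω ψ) (i : Fin d),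
        {p | ∫ x in Ω, p.fst x * partialD i ψ x = -∫ x in Ω, p.snd x i * ψ x} := by
    ext p
    simp only [mem_iInter, mem_ofPred_eq]
    rfl
  rw [h]
  refine isClosed_iInter fun ψ => isClosed_iInter fun hψ => isClosed_iInter fun i => ?_
  exact isClosed_eq
    ((continuous_integral_mul_partialD hψ i).comp (WithLp.fstL 2 ℝ (L2 Ω) (L2Vec Ω)).continuous)
    ((continuous_integral_coord_mul hψ i).comp
      (WithLp.sndL 2 ℝ (L2 Ω) (L2Vec Ω)).continuous).neg

instance completeSpace_H1 (Ω : Set (Eucl d)) : CompleteSpace (H1 Ω) :=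
  (isClosed_H1 Ω).completeSpace_coe

instance completeSpace_H01 (Ω : Set (Eucl d)) : CompleteSpace (H01 Ω) :=
  (testFunctions Ω).isClosed_topologicalClosure.completeSpace_coe

theorem partialD_coord_mul {ψ : Eucl d → ℝ} (hψ : Differentiable ℝ ψ) (i : Fin d) (x : Eucl d) :
    partialD i (fun y => y i * ψ y) x = ψ x + x i * partialD i ψ x := by
  have h1 : HasFDerivAt (fun y : Eucl d => y i) (EuclideanSpace.proj (𝕜 := ℝ) i) x :=
    (EuclideanSpace.proj (𝕜 := ℝ) i : Eucl d →L[ℝ] ℝ).hasFDerivAt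
  have h2 : fderiv ℝ (fun y : Eucl d => y i * ψ y) x = _ := (h1.mul (hψ x).hasFDerivAt).fderiv
  rw [partialD, h2]
  simp [partialD, add_comm]

theorem IsTestFunction.coord_mul {ψ : Eucl d → ℝ} (hψ : IsTestFunction Ω ψ) (i : Fin d) :
    IsTestFunction Ω fun y => y i * ψ y :=
  ⟨(EuclideanSpace.proj (𝕜 := ℝ) i : Eucl d →L[ℝ] ℝ).contDiff.mul hψ.1, hψ.2.1.mul_left,
    (tsupport_mul_subset_right (f := fun y : Eucl d => y i)).trans hψ.2.2⟩

theorem IsTestFunction.eq_zero_of_notMem {ψ : Eucl d → ℝ} (hψ : IsTestFunction Ω ψ) {x : Eucl d}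
    (hx : x ∉ Ω) : ψ x = 0 :=
  image_eq_zero_of_notMem_tsupport fun h => hx (hψ.2.2 h)

/-- Integration by parts gives `∫ ψ ∂ᵢ(xᵢψ) = -∫ xᵢ ψ ∂ᵢψ`, the product rule gives `∫ ψ² + ∫ xᵢ ψ
∂ᵢψ`; adding them cancels the last term. Since `xᵢψ` is again a test function, the right side can be
rewritten through a weak gradient, without identifying it with the classical gradient of `ψ`. -/
theorem IsTestFunction.integral_mul_self {ψ : Eucl d → ℝ} (hψ : IsTestFunction Ω ψ) (i : Fin d) :
    ∫ x in Ω, ψ x * ψ x = 2 * ∫ x in Ω, ψ x * partialD i (fun y => y i * ψ y) x := by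
  rw [setIntegral_eq_integral_of_forall_compl_eq_zero
      (fun x hx => by rw [hψ.eq_zero_of_notMem hx, zero_mul]),
    setIntegral_eq_integral_of_forall_compl_eq_zero
      (fun x hx => by rw [hψ.eq_zero_of_notMem hx, zero_mul])]
  have hχ := hψ.coord_mul i
  have hdψ : Differentiable ℝ ψ := hψ.1.differentiable (by simp)
  have hdχ : Differentiable ℝ fun y : Eucl d => y i * ψ y := hχ.1.differentiable (by simp)
  have hc : ∀ {f : Eucl d → ℝ}, ContDiff ℝ ∞ f → Continuous (partialD i f) := fun hf =>
    (hf.continuous_fderiv (by simp)).clm_apply continuous_const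
  have i1 : Integrable fun x => ψ x * partialD i (fun y => y i * ψ y) x :=
    (hψ.1.continuous.mul (hc hχ.1)).integrable_of_hasCompactSupport hψ.2.1.mul_right
  have i2 : Integrable fun x => partialD i ψ x * (x i * ψ x) :=
    ((hc hψ.1).mul hχ.1.continuous).integrable_of_hasCompactSupport hχ.2.1.mul_left
  have i3 : Integrable fun x => ψ x * (x i * ψ x) :=
    (hψ.1.continuous.mul hχ.1.continuous).integrable_of_hasCompactSupport hψ.2.1.mul_right
  have i4 : Integrable fun x => ψ x * ψ x :=
    (hψ.1.continuous.mul hψ.1.continuous).integrable_of_hasCompactSupport hψ.2.1.mul_right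
  have ibp : ∫ x, ψ x * partialD i (fun y => y i * ψ y) x
      = -∫ x, partialD i ψ x * (x i * ψ x) :=
    integral_mul_fderiv_eq_neg_fderiv_mul_of_integrable i2 i1 i3
      (fun x _ => hdψ x) (fun x _ => hdχ x)
  have expand : ∫ x, ψ x * partialD i (fun y => y i * ψ y) x
      = (∫ x, ψ x * ψ x) + ∫ x, partialD i ψ x * (x i * ψ x) := by
    rw [← integral_add i4 i2]
    refine integral_congr_ae (Eventually.of_forall fun x => ?_)
    simp only [partialD_coord_mul hdψ]
    ring
  linarith

/-- The Poincaré inequality for test functions. -/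
theorem poincare_testFunctions {R : ℝ} (hΩ : MeasurableSet Ω) (hR : ∀ x ∈ Ω, ‖x‖ ≤ R) (i : Fin d)
    {v : H1 Ω} (hv : v ∈ testFunctions Ω) :
    ‖(v : WithLp 2 (L2 Ω × L2Vec Ω)).fst‖ ≤ 2 * R * ‖(v : WithLp 2 (L2 Ω × L2Vec Ω)).snd‖ := by
  obtain ⟨ψ, hψ, hvψ⟩ := hv
  -- The weak gradient is tested against `xᵢψ`.
  have hw := v.2 _ (hψ.coord_mul i) i
  set f := (v : WithLp 2 (L2 Ω × L2Vec Ω)).fst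
  set g := (v : WithLp 2 (L2 Ω × L2Vec Ω)).snd
  have h1 : ‖f‖ ^ 2 = ∫ x in Ω, ψ x * ψ x := by
    rw [← real_inner_self_eq_norm_sq, L2.inner_def]
    refine integral_congr_ae ?_
    filter_upwards [hvψ] with x hx
    rw [hx]
    exact real_inner_comm _ _
  have h2 : ∫ x in Ω, f x * partialD i (fun y => y i * ψ y) x
      = ∫ x in Ω, ψ x * partialD i (fun y => y i * ψ y) x := by
    refine integral_congr_ae ?_
    filter_upwards [hvψ] with x hx
    rw [hx]
  have h3 : -∫ x in Ω, g x i * (x i * ψ x) ≤ R * (‖g‖ * ‖f‖) := by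
    rw [← integral_neg]
    calc ∫ x in Ω, -(g x i * (x i * ψ x)) ≤ ∫ x in Ω, R * (‖g x‖ * ‖f x‖) := by
          refine integral_mono_ae ((IsTestFunction.integrable_right (hψ.coord_mul i) g i).neg)
            ((integrable_norm_mul_norm g f).const_mul R) ?_
          filter_upwards [hvψ, ae_restrict_mem hΩ] with x hx hxΩ
          rw [hx]
          refine (neg_le_abs _).trans ?_
          rw [abs_mul, abs_mul, ← Real.norm_eq_abs, ← Real.norm_eq_abs, ← Real.norm_eq_abs]
          have hg := PiLp.norm_apply_le (g x) i
          have hx' := (PiLp.norm_apply_le x i).trans (hR x hxΩ)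
          calc ‖g x i‖ * (‖x i‖ * ‖ψ x‖) ≤ ‖g x‖ * (R * ‖ψ x‖) := by gcongr
            _ = R * (‖g x‖ * ‖ψ x‖) := by ring
      _ = R * ∫ x in Ω, ‖g x‖ * ‖f x‖ := integral_const_mul _ _
      _ ≤ R * (‖g‖ * ‖f‖) := by
          -- `R` may be negative only if `Ω` is empty, and then `g = 0`.
          rcases Ω.eq_empty_or_nonempty with rfl | ⟨x, hx⟩
          · have hg : g = 0 := by
              refine Lp.ext ?_
              simp [Filter.EventuallyEq]
            simp [hg]
          · have : 0 ≤ R := (norm_nonneg x).trans (hR x hx)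
            exact mul_le_mul_of_nonneg_left (integral_norm_mul_norm_le g f) this
  rcases (norm_nonneg f).eq_or_lt with h0 | h0
  · rw [← h0]
    rcases Ω.eq_empty_or_nonempty with rfl | ⟨x, hx⟩
    · have hg : g = 0 := by
        refine Lp.ext ?_
        simp [Filter.EventuallyEq]
      simp [hg]
    · have : 0 ≤ R := (norm_nonneg x).trans (hR x hx)
      positivity
  -- Together these give `‖f‖² ≤ 2R‖g‖‖f‖`, to be divided by `‖f‖ > 0`.
  · have h4 := hψ.integral_mul_self i
    refine le_of_mul_le_mul_right ?_ h0
    nlinarith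

/-- The Poincaré inequality on `H₀¹(Ω)`. -/
theorem poincare_H01 {R : ℝ} (hΩ : MeasurableSet Ω) (hR : ∀ x ∈ Ω, ‖x‖ ≤ R) (i : Fin d)
    (v : H01 Ω) : ‖toL2 Ω v‖ ≤ 2 * R * ‖weakGrad Ω v‖ := by
  have hcl : IsClosed {w : H1 Ω | ‖(w : WithLp 2 (L2 Ω × L2Vec Ω)).fst‖
      ≤ 2 * R * ‖(w : WithLp 2 (L2 Ω × L2Vec Ω)).snd‖} :=
    isClosed_le
      (((WithLp.fstL 2 ℝ (L2 Ω) (L2Vec Ω)).continuous.comp continuous_subtype_val).norm)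
      (continuous_const.mul
        ((WithLp.sndL 2 ℝ (L2 Ω) (L2Vec Ω)).continuous.comp continuous_subtype_val).norm)
  exact closure_minimal (fun w hw => poincare_testFunctions hΩ hR i hw) hcl v.2

theorem norm_sq_H01 (v : H01 Ω) : ‖v‖ ^ 2 = ‖toL2 Ω v‖ ^ 2 + ‖weakGrad Ω v‖ ^ 2 :=
  WithLp.prod_norm_sq_eq_of_L2 _

theorem negLaplacian_self (v : H01 Ω) : negLaplacian Ω v v = ‖weakGrad Ω v‖ ^ 2 :=
  real_inner_self_eq_norm_sq (weakGrad Ω v)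

/-- `-Δ` is coercive on `H₀¹(Ω)` for bounded `Ω` in positive dimension. -/
theorem isCoercive_negLaplacian [NeZero d] (hΩ : MeasurableSet Ω) (hΩb : Bornology.IsBounded Ω) :
    IsCoercive (negLaplacian Ω) := by
  obtain ⟨R, hR0, hR⟩ := hΩb.exists_pos_norm_le
  -- By Poincaré, `‖v‖² ≤ ((2R)² + 1)‖∇v‖²`.
  refine ⟨(1 + (2 * R) ^ 2)⁻¹, by positivity, fun v => ?_⟩
  have h := poincare_H01 hΩ hR 0 v
  rw [negLaplacian_self, mul_assoc, ← sq, norm_sq_H01, inv_mul_le_iff₀ (by positivity)]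
  nlinarith [pow_le_pow_left₀ (norm_nonneg _) h 2]

end Sobolev

/-- The Lax–Milgram theorem for functionals. -/
theorem IsCoercive.existsUnique_apply_eq {V : Type*} [NormedAddCommGroup V] [InnerProductSpace ℝ V]
    [CompleteSpace V] {B : V →L[ℝ] V →L[ℝ] ℝ} (hB : IsCoercive B) (h : V →L[ℝ] ℝ) :
    ∃! w : V, ∀ z, B w z = h z := by
  refine ⟨hB.continuousLinearEquivOfBilin.symm ((InnerProductSpace.toDual ℝ V).symm h), ?_, ?_⟩
  · intro z
    rw [← hB.continuousLinearEquivOfBilin_apply, ContinuousLinearEquiv.apply_symm_apply,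
      InnerProductSpace.toDual_symm_apply]
  · intro w hw
    rw [ContinuousLinearEquiv.eq_symm_apply]
    refine (hB.unique_continuousLinearEquivOfBilin fun z => ?_).symm
    rw [InnerProductSpace.toDual_symm_apply, hw]

/-! ### Pointwise bounds, positivity and measurability of `GP` -/

section Pointwise

variable {d : ℕ}

theorem clip_nonneg (t : ℝ) : 0 ≤ clip t := le_min zero_le_one (le_max_left _ _)

theorem clipDeriv_nonneg (t : ℝ) : 0 ≤ clipDeriv t :=
  indicator_nonneg (fun _ _ => zero_le_one) t

theorem clipDeriv_le_one (t : ℝ) : clipDeriv t ≤ 1 :=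
  indicator_le_self' (fun _ _ => zero_le_one) t

/-- This bounds the eigenvalue of `GP` orthogonal to `ξ`; `c ≥ 0` is what keeps it bounded as `ξ →
0`. -/
theorem clip_sub_mul_inv_le_one {c t : ℝ} (hc : 0 ≤ c) (ht : 0 ≤ t) :
    clip (t - c) * t⁻¹ ≤ 1 := by
  have h : clip (t - c) ≤ t := (min_le_right _ _).trans (max_le ht (by linarith))
  rcases ht.eq_or_lt with rfl | ht
  · simp
  · rwa [← div_eq_mul_inv, div_le_one ht]

theorem measurable_clip : Measurable clip :=
  measurable_const.min (measurable_const.max measurable_id)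

theorem measurable_clipDeriv : Measurable clipDeriv :=
  measurable_const.indicator measurableSet_Ioo

theorem GP_add (c : ℝ) (ξ η ζ : Eucl d) : GP c ξ (η + ζ) = GP c ξ η + GP c ξ ζ := by
  simp only [GP, Gb, Qproj, inner_add_right]
  module

theorem GP_smul (c a : ℝ) (ξ η : Eucl d) : GP c ξ (a • η) = a • GP c ξ η := by
  simp only [GP, Gb, Qproj, inner_smul_right]
  module

theorem inner_sq_div_le (ξ η : Eucl d) : (inner ℝ ξ η / ‖ξ‖) ^ 2 ≤ ‖η‖ ^ 2 := by
  rw [← sq_abs]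
  refine pow_le_pow_left₀ (abs_nonneg _) ?_ 2
  rw [abs_div, abs_norm]
  exact div_le_of_le_mul₀ (norm_nonneg _) (norm_nonneg _)
    ((abs_real_inner_le_norm ξ η).trans_eq (mul_comm _ _))

/-- The spectral splitting of the quadratic form: the squared component of `η` along `ξ`, and the
squared remainder by Pythagoras, each with its eigenvalue as weight. -/
theorem inner_GP_self (c : ℝ) (ξ η : Eucl d) :
    inner ℝ (GP c ξ η) η = clipDeriv (‖ξ‖ - c) * (inner ℝ ξ η / ‖ξ‖) ^ 2
      + bClip c ξ * ‖ξ‖⁻¹ * (‖η‖ ^ 2 - (inner ℝ ξ η / ‖ξ‖) ^ 2) := by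
  simp only [GP, Gb, Qproj, qDir, inner_add_left, inner_smul_left, inner_sub_left,
    real_inner_self_eq_norm_sq, conj_trivial]
  ring

theorem inner_GP_self_nonneg (c : ℝ) (ξ η : Eucl d) : 0 ≤ inner ℝ (GP c ξ η) η := by
  rw [inner_GP_self]
  have h1 := clipDeriv_nonneg (‖ξ‖ - c)
  have h2 : 0 ≤ bClip c ξ := clip_nonneg _
  have h3 := sub_nonneg.2 (inner_sq_div_le ξ η)
  positivity

theorem norm_Qproj_arg_le (ξ η : Eucl d) : ‖η - (inner ℝ ξ η / ‖ξ‖ ^ 2) • ξ‖ ≤ ‖η‖ := by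
  rcases eq_or_ne ξ 0 with rfl | hξ
  · simp
  have hξ' : ‖ξ‖ ≠ 0 := norm_ne_zero_iff.2 hξ
  refine (sq_le_sq₀ (norm_nonneg _) (norm_nonneg _)).1 ?_
  have h : ‖η - (inner ℝ ξ η / ‖ξ‖ ^ 2) • ξ‖ ^ 2 = ‖η‖ ^ 2 - (inner ℝ ξ η / ‖ξ‖) ^ 2 := by
    rw [norm_sub_sq_real, real_inner_smul_right, real_inner_comm, norm_smul, mul_pow,
      Real.norm_eq_abs, sq_abs]
    field_simp
    ring
  rw [h]
  exact sub_le_self _ (sq_nonneg _)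

/-- The factor 2 comes from the triangle inequality, each of the two summands having norm at most
`‖η‖`. -/
theorem norm_GP_le {c : ℝ} (hc : 0 ≤ c) (ξ η : Eucl d) : ‖GP c ξ η‖ ≤ 2 * ‖η‖ := by
  have hq : ‖qDir ξ‖ ≤ 1 := by
    rw [qDir, norm_smul, norm_inv, norm_norm]
    exact inv_mul_le_one
  have h1 : ‖Gb c ξ η • qDir ξ‖ ≤ ‖η‖ := by
    rw [norm_smul, Gb, norm_mul, Real.norm_of_nonneg (clipDeriv_nonneg _)]
    have : ‖inner ℝ ξ η / ‖ξ‖‖ ≤ ‖η‖ :=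
      abs_le_of_sq_le_sq (inner_sq_div_le ξ η) (norm_nonneg _)
    calc _ ≤ 1 * ‖η‖ * 1 := by
          gcongr
          exact clipDeriv_le_one _
      _ = ‖η‖ := by ring
  have h2 : ‖bClip c ξ • Qproj ξ η‖ ≤ ‖η‖ := by
    have hb : 0 ≤ bClip c ξ * ‖ξ‖⁻¹ := mul_nonneg (clip_nonneg _) (inv_nonneg.2 (norm_nonneg _))
    rw [Qproj, smul_smul, norm_smul, Real.norm_of_nonneg hb]
    calc _ ≤ 1 * ‖η‖ := by
          gcongr
          · exact clip_sub_mul_inv_le_one hc (norm_nonneg _)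
          · exact norm_Qproj_arg_le ξ η
      _ = ‖η‖ := one_mul _
  calc ‖GP c ξ η‖ ≤ _ := norm_add_le _ _
    _ ≤ 2 * ‖η‖ := by linarith

theorem AEMeasurable.GP {α : Type*} [MeasurableSpace α] {μ : Measure α} {φ : α → ℝ}
    {ξ η : α → Eucl d} (hφ : AEMeasurable φ μ) (hξ : AEMeasurable ξ μ) (hη : AEMeasurable η μ) :
    AEMeasurable (fun x => GP (φ x) (ξ x) (η x)) μ := by
  have h := hξ.norm.sub hφ
  have h1 := measurable_clip.comp_aemeasurable h
  have h2 := measurable_clipDeriv.comp_aemeasurable h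
  have hi := hξ.inner (𝕜 := ℝ) hη
  exact ((h2.mul (hi.div hξ.norm)).smul (hξ.norm.inv.smul hξ)).add
    (h1.smul (hξ.norm.inv.smul (hη.sub ((hi.div (hξ.norm.pow_const 2)).smul hξ))))

end Pointwise

/-! ### The bilinear form induced by `GP` on `L²` -/

section NewtonDerivative

variable {α : Type*} [MeasurableSpace α] {μ : Measure α} {d : ℕ} {φ : α → ℝ} {ξ : α → Eucl d}

theorem ae_norm_inner_GP_le (hφ0 : ∀ᵐ x ∂μ, 0 ≤ φ x) (f g : α → Eucl d) :
    ∀ᵐ x ∂μ, ‖inner ℝ (GP (φ x) (ξ x) (f x)) (g x)‖ ≤ 2 * (‖f x‖ * ‖g x‖) := by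
  filter_upwards [hφ0] with x hx
  calc _ ≤ ‖GP (φ x) (ξ x) (f x)‖ * ‖g x‖ := norm_inner_le_norm _ _
    _ ≤ 2 * ‖f x‖ * ‖g x‖ := by gcongr; exact norm_GP_le hx _ _
    _ = _ := mul_assoc _ _ _

theorem integrable_inner_GP (hφ : AEMeasurable φ μ) (hφ0 : ∀ᵐ x ∂μ, 0 ≤ φ x)
    (hξ : AEMeasurable ξ μ) (f g : Lp (Eucl d) 2 μ) :
    Integrable (fun x => inner ℝ (GP (φ x) (ξ x) (f x)) (g x)) μ := by
  refine ((integrable_norm_mul_norm f g).const_mul 2).mono' ?_ (ae_norm_inner_GP_le hφ0 f g)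
  exact ((hφ.GP hξ (Lp.aestronglyMeasurable f).aemeasurable).inner
    (Lp.aestronglyMeasurable g).aemeasurable).aestronglyMeasurable

/-- The bounded bilinear form `(f, g) ↦ ∫_s (G_P(φ, ξ) f) · g` on `L²(μ)^d`. -/
noncomputable def formGP (hφ : AEMeasurable φ μ) (hφ0 : ∀ᵐ x ∂μ, 0 ≤ φ x) (hξ : AEMeasurable ξ μ)
    (s : Set α) : Lp (Eucl d) 2 μ →L[ℝ] Lp (Eucl d) 2 μ →L[ℝ] ℝ :=
  LinearMap.mkContinuous₂
    (LinearMap.mk₂ ℝ (fun f g => ∫ x in s, inner ℝ (GP (φ x) (ξ x) (f x)) (g x) ∂μ)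
      (by
        intro f₁ f₂ g
        rw [← integral_add (integrable_inner_GP hφ hφ0 hξ f₁ g).integrableOn
          (integrable_inner_GP hφ hφ0 hξ f₂ g).integrableOn]
        refine integral_congr_ae (ae_restrict_of_ae ?_)
        filter_upwards [Lp.coeFn_add f₁ f₂] with x hx
        rw [hx, Pi.add_apply, GP_add, inner_add_left])
      (by
        intro c f g
        rw [smul_eq_mul, ← integral_const_mul]
        refine integral_congr_ae (ae_restrict_of_ae ?_)
        filter_upwards [Lp.coeFn_smul c f] with x hx
        rw [hx, Pi.smul_apply, GP_smul, real_inner_smul_left])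
      (by
        intro f g₁ g₂
        rw [← integral_add (integrable_inner_GP hφ hφ0 hξ f g₁).integrableOn
          (integrable_inner_GP hφ hφ0 hξ f g₂).integrableOn]
        refine integral_congr_ae (ae_restrict_of_ae ?_)
        filter_upwards [Lp.coeFn_add g₁ g₂] with x hx
        rw [hx, Pi.add_apply, inner_add_right])
      (by
        intro c f g
        rw [smul_eq_mul, ← integral_const_mul]
        refine integral_congr_ae (ae_restrict_of_ae ?_)
        filter_upwards [Lp.coeFn_smul c g] with x hx
        rw [hx, Pi.smul_apply, real_inner_smul_right]))
    2
    (by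
      intro f g
      have hi := (integrable_norm_mul_norm f g).const_mul 2
      calc ‖∫ x in s, inner ℝ (GP (φ x) (ξ x) (f x)) (g x) ∂μ‖
          ≤ ∫ x in s, 2 * (‖f x‖ * ‖g x‖) ∂μ :=
            norm_integral_le_of_norm_le hi.integrableOn
              (ae_restrict_of_ae (ae_norm_inner_GP_le hφ0 f g))
        _ ≤ ∫ x, 2 * (‖f x‖ * ‖g x‖) ∂μ :=
            setIntegral_le_integral hi (Eventually.of_forall fun x => by positivity)
        _ = 2 * ∫ x, ‖f x‖ * ‖g x‖ ∂μ := integral_const_mul _ _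
        _ ≤ 2 * (‖f‖ * ‖g‖) := by gcongr; exact integral_norm_mul_norm_le f g
        _ = 2 * ‖f‖ * ‖g‖ := (mul_assoc _ _ _).symm)

theorem formGP_self_nonneg (hφ : AEMeasurable φ μ) (hφ0 : ∀ᵐ x ∂μ, 0 ≤ φ x)
    (hξ : AEMeasurable ξ μ) (s : Set α) (f : Lp (Eucl d) 2 μ) : 0 ≤ formGP hφ hφ0 hξ s f f :=
  integral_nonneg fun _ => inner_GP_self_nonneg _ _ _

end NewtonDerivative

/-! ### Construction of the operator and unique solvability -/

theorem mainTheorem6 {d : ℕ} (hd : d = 1 ∨ d = 2)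
    (Ω : Set (Eucl d)) (hΩ : IsOpen Ω) (hΩb : Bornology.IsBounded Ω)
    (φ : Eucl d → ℝ) (hφ : AEMeasurable φ (volume.restrict Ω))
    (ν : ℝ) (hν : 0 < ν) (hφν : ∀ᵐ x ∂(volume.restrict Ω), ν ≤ φ x)
    (ε : ℝ) (hε : 0 < ε)
    (Dμ : L2 Ω →L[ℝ] L2Vec Ω)
    (D : H01 Ω →L[ℝ] L2Vec Ω) (hD : D = weakGrad Ω ∨ D = Dμ.comp (toL2 Ω))
    (u : H01 Ω) :
    ∃ G : H01 Ω →L[ℝ] Hminus1 Ω, IsGcalP φ D u G ∧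
      (∀ z : H01 Ω, 0 ≤ G z z) ∧
      ∀ h : Hminus1 Ω, ∃! w : H01 Ω,
        ∀ z : H01 Ω, ε * negLaplacian Ω w z + G w z = h z := by
  have : NeZero d := ⟨by omega⟩
  have hm := hΩ.measurableSet
  have hφ0 : ∀ᵐ x ∂(volume.restrict Ω), 0 ≤ φ x := hφν.mono fun x hx => hν.le.trans hx
  have hξ : AEMeasurable (fun x => D u x) (volume.restrict Ω) :=
    (Lp.aestronglyMeasurable (D u)).aemeasurable
  have hsub : OmegaPlus D u ⊆ Ω := fun x hx => hx.1
  have hrestrict : (volume.restrict Ω).restrict (OmegaPlus D u)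
      = volume.restrict (OmegaPlus D u) := Measure.restrict_restrict_of_subset hsub
  let F := formGP hφ hφ0 hξ (OmegaPlus D u)
  let G : H01 Ω →L[ℝ] Hminus1 Ω := (D.precomp ℝ).comp (F.comp D)
  have hG : ∀ z : H01 Ω, 0 ≤ G z z := fun z => formGP_self_nonneg hφ hφ0 hξ _ (D z)
  refine ⟨G, fun v w => ⟨?_, ?_⟩, hG, fun h => ?_⟩
  · rw [IntegrableOn, ← hrestrict]
    exact (integrable_inner_GP hφ hφ0 hξ (D v) (D w)).integrableOn
  · rw [← hrestrict]
    rfl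
  -- Monotonicity of `G` lets the coercivity constant of `ε(-Δ)` survive unchanged.
  · have hcoer : IsCoercive (ε • negLaplacian Ω + G) := by
      obtain ⟨C, hC, hCv⟩ := isCoercive_negLaplacian hm hΩb
      refine ⟨ε * C, by positivity, fun v => ?_⟩
      calc ε * C * ‖v‖ * ‖v‖ = ε * (C * ‖v‖ * ‖v‖) := by ring
        _ ≤ ε * negLaplacian Ω v v := by gcongr; exact hCv v
        _ ≤ ε * negLaplacian Ω v v + G v v := le_add_of_nonneg_right (hG v)
    exact hcoer.existsUnique_apply_eq h
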